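/- Let $R$ be an integral domain with field of fractions $K$. For nonzero fractional ideals $I, J$ of $R$ put $(J:I)=\{x\in K \mid xI\subseteq J\}$, $I_v=(R:(R:I))$ and $I_t=\bigcup J_v$, the union being taken over all nonzero finitely generated fractional ideals $J\subseteq I$. All ideals below are understood to be nonzero. A fractional ideal $I$ is *divisorial* if $I=I_v$, a *$t$-ideal* if $I=I_t$, *$t$-invertible* if $(I(R:I))_t=R$, *strong* if $(R:I)=(I:I)$, and *strongly divisorial* if it is both strong and divisorial. A *maximal $t$-ideal* is a maximal element of the set of $t$-ideals properly contained in $R$; an ideal is *proper* if it is properly contained in $R$. The domain $R$ is *completely integrally closed* if every $x\in K$ for which there is a nonzero $d\in R$ with $dx^i\in R$ for all $i\ge 0$ belongs to $R$. It is a *Krull domain* if it is the intersection of a (possibly empty) family of discrete valuation rings with field of fractions $K$ (the empty intersection being $K$) such that each nonzero element of $K$ is a unit in all but finitely many of them. **Theorem.** For any domain $R$ the following conditions are equivalent: 1. $R$ has no proper strong $t$-ideals; 2. $R$ has no strong prime $t$-ideals; 3. $R$ has no strongly divisorial prime ideals and each maximal $t$-ideal is $t$-invertible; 4. $R$ has no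 strongly divisorial prime ideals and each maximal $t$-ideal is divisorial; 5. $R$ is completely integrally closed and each maximal $t$-ideal is divisorial; 6. $R$ is a Krull domain; 7. each $t$-ideal of $R$ is $t$-invertible. -/

import Mathlib

open scoped nonZeroDivisors

noncomputable section

namespace StarIdeal

/- Throughout, `R` is a domain with field of fractions `K`, and fractional ideals are elements of
`FractionalIdeal R⁰ K`, where the whole ring is `1`. For a nonzero fractional ideal `I`, Mathlib's
quotient `J / I` is the colon `(J : I) = {x ∈ K | x I ⊆ J}`. As usual in this context, all ideals
(divisorial ideals, `t`-ideals, strong ideals, ...) are nonzero. -/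

variable {R : Type*} [CommRing R] [IsDomain R] {K : Type*} [Field K] [Algebra R K]
  [IsFractionRing R K]

/-- The colon `(J : I)` of fractional ideals, for nonzero `I`, is `{x ∈ K | x I ⊆ J}`. -/
theorem mem_colon {I : FractionalIdeal R⁰ K} (hI : I ≠ 0) (J : FractionalIdeal R⁰ K) (x : K) :
    x ∈ J / I ↔ ∀ y ∈ I, x * y ∈ J :=
  FractionalIdeal.mem_div_iff_of_ne_zero hI

/-- The `v`-closure `I_v = (R : (R : I))`. -/
def vClosure (I : FractionalIdeal R⁰ K) : FractionalIdeal R⁰ K := 1 / (1 / I)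

theorem vClosure_zero : vClosure (0 : FractionalIdeal R⁰ K) = 0 := by
  simp [vClosure, FractionalIdeal.div_zero]

theorem one_div_ne_zero' {I : FractionalIdeal R⁰ K} (hI : I ≠ 0) :
    (1 / I : FractionalIdeal R⁰ K) ≠ 0 := by
  obtain ⟨a, J, ha, rfl⟩ := FractionalIdeal.exists_eq_spanSingleton_mul I
  have ha' : algebraMap R K a ≠ 0 := by simpa using ha
  intro h
  have h1 : algebraMap R K a ∈ (1 / (FractionalIdeal.spanSingleton R⁰ (algebraMap R K a)⁻¹ * J) :
      FractionalIdeal R⁰ K) := by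
    rw [mem_colon hI]
    intro y hy
    obtain ⟨z, hz, rfl⟩ := FractionalIdeal.mem_singleton_mul.1 hy
    rw [← mul_assoc, mul_inv_cancel₀ ha', one_mul]
    exact FractionalIdeal.coeIdeal_le_one hz
  rw [h, FractionalIdeal.mem_zero_iff] at h1
  exact ha' h1

theorem vClosure_mono {I J : FractionalIdeal R⁰ K} (h : I ≤ J) : vClosure I ≤ vClosure J := by
  by_cases hI : I = 0
  · rw [hI, vClosure_zero]
    exact FractionalIdeal.zero_le _
  have hJ : J ≠ 0 := fun hJ => hI (le_antisymm (hJ ▸ h) (FractionalIdeal.zero_le _))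
  intro x hx
  change x ∈ vClosure I at hx
  rw [vClosure, mem_colon (one_div_ne_zero' ‹_›)] at hx ⊢
  intro y hy
  refine hx y ?_
  rw [mem_colon ‹_›] at hy ⊢
  exact fun z hz => hy z (h hz)

/-- The `t`-closure `I_t`: the union of the `J_v`, where `J` runs over the finitely generated
fractional ideals contained in `I`. -/
def tClosure (I : FractionalIdeal R⁰ K) : FractionalIdeal R⁰ K :=
  ⟨{ carrier := {x | ∃ J : FractionalIdeal R⁰ K,
        (J : Submodule R K).FG ∧ J ≤ I ∧ x ∈ vClosure J}
     zero_mem' := ⟨0, by simpa using Submodule.fg_bot, FractionalIdeal.zero_le _,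
        (vClosure (0 : FractionalIdeal R⁰ K) : Submodule R K).zero_mem⟩
     add_mem' := by
        rintro x y ⟨J, hJ, hJI, hx⟩ ⟨L, hL, hLI, hy⟩
        refine ⟨J ⊔ L, ?_, sup_le hJI hLI, ?_⟩
        · rw [FractionalIdeal.coe_sup]
          exact hJ.sup hL
        · exact (vClosure (J ⊔ L) : Submodule R K).add_mem
            (vClosure_mono le_sup_left hx) (vClosure_mono le_sup_right hy)
     smul_mem' := by
        rintro c x ⟨J, hJ, hJI, hx⟩
        exact ⟨J, hJ, hJI, (vClosure J : Submodule R K).smul_mem c hx⟩ },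
   by
    obtain ⟨a, ha, h⟩ := (vClosure I).isFractional
    refine ⟨a, ha, ?_⟩
    rintro x ⟨J, -, hJI, hx⟩
    exact h x (vClosure_mono hJI hx)⟩

theorem mem_tClosure (I : FractionalIdeal R⁰ K) (x : K) :
    x ∈ tClosure I ↔ ∃ J : FractionalIdeal R⁰ K,
      (J : Submodule R K).FG ∧ J ≤ I ∧ x ∈ vClosure J :=
  Iff.rfl

/-- A nonzero fractional ideal `I` is divisorial (a `v`-ideal) if `I_v = I`. -/
def IsDivisorial (I : FractionalIdeal R⁰ K) : Prop := I ≠ 0 ∧ vClosure I = I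

/-- A nonzero fractional ideal `I` is a `t`-ideal if `I_t = I`. -/
def IsTIdeal (I : FractionalIdeal R⁰ K) : Prop := I ≠ 0 ∧ tClosure I = I

/-- A nonzero fractional ideal `I` is strong (a trace ideal) if `(R : I) = (I : I)`. -/
def IsStrong (I : FractionalIdeal R⁰ K) : Prop := I ≠ 0 ∧ 1 / I = I / I

/-- Strongly divisorial: strong and divisorial. -/
def IsStronglyDivisorial (I : FractionalIdeal R⁰ K) : Prop := IsStrong I ∧ IsDivisorial I

/-- A proper integral ideal of `R`, seen as a fractional ideal. -/
def IsProper (I : FractionalIdeal R⁰ K) : Prop := I ≤ 1 ∧ I ≠ 1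

/-- A maximal `t`-ideal: maximal in the set of proper integral `t`-ideals. -/
def IsMaximalTIdeal (I : FractionalIdeal R⁰ K) : Prop :=
  Maximal (fun J : FractionalIdeal R⁰ K => IsTIdeal J ∧ IsProper J) I

/-- A nonzero fractional ideal `I` is `t`-invertible if `(I (R : I))_t = R`. -/
def IsTInvertible (I : FractionalIdeal R⁰ K) : Prop := I ≠ 0 ∧ tClosure (I * (1 / I)) = 1

/-- `I` is a prime ideal of `R`, seen as a fractional ideal. -/
def IsPrimeIdeal (I : FractionalIdeal R⁰ K) : Prop :=
  ∃ P : Ideal R, P.IsPrime ∧ (P : FractionalIdeal R⁰ K) = I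

variable (R K)

/-- `R` is completely integrally closed: every element of `K` that is almost integral over `R`
lies in `R`. -/
def IsCompletelyIntegrallyClosed : Prop := completeIntegralClosure R K = ⊥

/-- `R` is a Krull domain: it is the intersection of a (possibly empty) family of discrete
valuation rings of `K` such that every nonzero element of `K` is a unit in all but finitely many
of them. -/
def IsKrullDomain : Prop :=
  ∃ S : Set (ValuationSubring K),
    (∀ V ∈ S, IsDiscreteValuationRing V) ∧
    (∀ x : K, x ∈ (algebraMap R K).range ↔ ∀ V ∈ S, x ∈ V) ∧
    (∀ x : K, x ≠ 0 → {V ∈ S | ¬ (x ∈ V ∧ x⁻¹ ∈ V)}.Finite)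

end StarIdeal

end

set_option linter.unusedSectionVars false

namespace StarIdeal

/-! ### The `v`- and `t`-closures, and existence of maximal `t`-ideals. -/

section Closure

variable {R : Type*} [CommRing R] [IsDomain R] {K : Type*} [Field K] [Algebra R K]
  [IsFractionRing R K]

open FractionalIdeal

/-! The implications are 1 → 2 → 3 → 4 → 6 → 7 → 1 together with 6 → 5 → 4; the substance lies in 4
→ 6 and 6 → 7. A maximal `t`-ideal M is prime, and since M ⊆ M(R:M) ⊆ R it is either strong or
`t`-invertible.

For 4 → 6, the elements r with r(R:M)^n ⊆ R for all n form a prime ideal, which is strongly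
divisorial if nonzero (`powResidual_isPrime`, `powResidual_isStronglyDivisorial`). Hence it
vanishes, and every nonzero x in R has a finite order at M. As M is not strong, there are p ∈ M and
l ∈ (R:M) with pl ∈ R outside M; then l⁻¹ is a uniformizer of R_M, which is a discrete valuation
ring. R is the intersection of the R_M, and finite character holds because xR contains a product of
maximal `t`-ideals (`finite_setOf_isMaximalTIdeal_mem`).

For 6 → 7, finite character yields a finitely generated J ⊆ I(R:I) with the same inverse
(`IsKrullDomain.exists_fg_one_div_eq`), and complete integral closedness makes that inverse R. -/

theorem mem_one_div {I : FractionalIdeal R⁰ K} (hI : I ≠ 0) (x : K) :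
    x ∈ 1 / I ↔ ∀ y ∈ I, x * y ∈ (1 : FractionalIdeal R⁰ K) :=
  mem_colon hI 1 x

theorem ne_zero_of_le {I J : FractionalIdeal R⁰ K} (hI : I ≠ 0) (h : I ≤ J) : J ≠ 0 :=
  fun hJ => hI (le_antisymm (hJ ▸ h) (FractionalIdeal.zero_le _))

theorem one_div_antitone {I J : FractionalIdeal R⁰ K} (hI : I ≠ 0) (h : I ≤ J) :
    1 / J ≤ 1 / I := by
  intro x hx
  change x ∈ 1 / J at hx
  rw [mem_one_div (ne_zero_of_le hI h)] at hx
  exact (mem_one_div hI x).2 fun y hy => hx y (h hy)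

theorem le_vClosure (I : FractionalIdeal R⁰ K) : I ≤ vClosure I := by
  by_cases hI : I = 0
  · rw [hI]; exact FractionalIdeal.zero_le _
  intro x hx
  change x ∈ 1 / (1 / I)
  rw [mem_one_div (one_div_ne_zero' hI)]
  intro y hy
  rw [mul_comm]
  exact (mem_one_div hI y).1 hy x hx

theorem one_div_vClosure {I : FractionalIdeal R⁰ K} (hI : I ≠ 0) :
    1 / vClosure I = 1 / I :=
  le_antisymm (one_div_antitone hI (le_vClosure I)) (le_vClosure (1 / I))

theorem vClosure_vClosure (I : FractionalIdeal R⁰ K) : vClosure (vClosure I) = vClosure I := by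
  by_cases hI : I = 0
  · rw [hI, vClosure_zero, vClosure_zero]
  · rw [vClosure, one_div_vClosure hI, vClosure]

theorem isDivisorial_one_div {I : FractionalIdeal R⁰ K} (hI : I ≠ 0) : IsDivisorial (1 / I) :=
  ⟨one_div_ne_zero' hI, one_div_vClosure hI⟩

theorem vClosure_one : vClosure (1 : FractionalIdeal R⁰ K) = 1 := by
  simp [vClosure, FractionalIdeal.div_one]

theorem exists_mem_ne_zero {I : FractionalIdeal R⁰ K} (hI : I ≠ 0) : ∃ x ∈ I, x ≠ 0 := by
  by_contra! h
  exact hI (FractionalIdeal.eq_zero_iff.2 h)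

theorem ne_zero_of_mem {I : FractionalIdeal R⁰ K} {x : K} (hx : x ∈ I) (h : x ≠ 0) : I ≠ 0 := by
  rintro rfl
  exact h ((FractionalIdeal.mem_zero_iff R⁰).1 hx)

theorem mul_ne_zero_of_ne_zero {I J : FractionalIdeal R⁰ K} (hI : I ≠ 0) (hJ : J ≠ 0) :
    I * J ≠ 0 := by
  obtain ⟨x, hx, hx0⟩ := exists_mem_ne_zero hI
  obtain ⟨y, hy, hy0⟩ := exists_mem_ne_zero hJ
  exact ne_zero_of_mem (FractionalIdeal.mul_mem_mul hx hy) (mul_ne_zero hx0 hy0)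

theorem mul_vClosure_le (A B : FractionalIdeal R⁰ K) : A * vClosure B ≤ vClosure (A * B) := by
  by_cases hA : A = 0
  · simp [hA]
  by_cases hB : B = 0
  · simp [hB, vClosure_zero]
  refine FractionalIdeal.mul_le.2 fun a ha x hx => ?_
  change a * x ∈ 1 / (1 / (A * B))
  have hAB : A * B ≠ 0 := mul_ne_zero_of_ne_zero hA hB
  rw [mem_one_div (one_div_ne_zero' hAB)]
  intro z hz
  rw [mem_one_div hAB] at hz
  have h1 : a * z ∈ 1 / B := by
    rw [mem_one_div hB]
    intro b hb
    have := hz _ (FractionalIdeal.mul_mem_mul ha hb)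
    rwa [← mul_assoc, mul_comm z] at this
  have h2 := (mem_one_div (one_div_ne_zero' hB) x).1 hx _ h1
  rwa [← mul_assoc, mul_comm x] at h2

theorem le_tClosure (I : FractionalIdeal R⁰ K) : I ≤ tClosure I := by
  intro x hx
  refine ⟨spanSingleton R⁰ x, ?_, spanSingleton_le_iff_mem.2 hx,
    le_vClosure _ (mem_spanSingleton_self R⁰ x)⟩
  rw [coe_spanSingleton]
  exact Submodule.fg_span_singleton x

theorem tClosure_mono {I J : FractionalIdeal R⁰ K} (h : I ≤ J) : tClosure I ≤ tClosure J := by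
  rintro x ⟨A, hA, hAI, hx⟩
  exact ⟨A, hA, hAI.trans h, hx⟩

theorem tClosure_le_vClosure (I : FractionalIdeal R⁰ K) : tClosure I ≤ vClosure I := by
  rintro x ⟨A, -, hAI, hx⟩
  exact vClosure_mono hAI hx

theorem tClosure_one : tClosure (1 : FractionalIdeal R⁰ K) = 1 :=
  le_antisymm ((tClosure_le_vClosure 1).trans_eq vClosure_one) (le_tClosure 1)

/-- The union defining the `t`-closure is directed, so one finitely generated ideal serves all
generators of J. This gives idempotence. -/
theorem exists_fg_le_vClosure {I J : FractionalIdeal R⁰ K} (hJ : (J : Submodule R K).FG)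
    (h : J ≤ tClosure I) :
    ∃ A : FractionalIdeal R⁰ K, (A : Submodule R K).FG ∧ A ≤ I ∧ J ≤ vClosure A := by
  classical
  obtain ⟨s, hs⟩ := hJ
  have key : ∀ t : Finset K, (∀ x ∈ t, x ∈ tClosure I) →
      ∃ A : FractionalIdeal R⁰ K, (A : Submodule R K).FG ∧ A ≤ I ∧ ∀ x ∈ t, x ∈ vClosure A := by
    intro t
    induction t using Finset.induction_on with
    | empty =>
      exact fun _ => ⟨0, by simpa using Submodule.fg_bot, FractionalIdeal.zero_le _, by simp⟩
    | insert a t _ ih =>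
      intro ht
      obtain ⟨A, hA, hAI, h1⟩ := ih fun x hx => ht x (Finset.mem_insert_of_mem hx)
      obtain ⟨B, hB, hBI, h2⟩ := ht a (Finset.mem_insert_self a t)
      refine ⟨A ⊔ B, ?_, sup_le hAI hBI, fun x hx => ?_⟩
      · rw [FractionalIdeal.coe_sup]
        exact hA.sup hB
      · rcases Finset.mem_insert.1 hx with rfl | hx
        · exact vClosure_mono le_sup_right h2
        · exact vClosure_mono le_sup_left (h1 x hx)
  obtain ⟨A, hA, hAI, h1⟩ := key s fun x hx => h (by
    change x ∈ (J : Submodule R K)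
    rw [← hs]
    exact Submodule.subset_span hx)
  refine ⟨A, hA, hAI, ?_⟩
  rw [← FractionalIdeal.coe_le_coe, ← hs]
  exact Submodule.span_le.2 h1

theorem tClosure_tClosure (I : FractionalIdeal R⁰ K) : tClosure (tClosure I) = tClosure I := by
  refine le_antisymm ?_ (le_tClosure _)
  rintro x ⟨J, hJ, hJI, hx⟩
  obtain ⟨A, hA, hAI, hJA⟩ := exists_fg_le_vClosure hJ hJI
  refine ⟨A, hA, hAI, ?_⟩
  rw [← vClosure_vClosure]
  exact vClosure_mono hJA hx

theorem mul_tClosure_le (A B : FractionalIdeal R⁰ K) : A * tClosure B ≤ tClosure (A * B) := by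
  refine FractionalIdeal.mul_le.2 fun a ha x hx => ?_
  obtain ⟨J, hJ, hJB, hx⟩ := hx
  refine ⟨spanSingleton R⁰ a * J, ?_, mul_le_mul' (spanSingleton_le_iff_mem.2 ha) hJB,
    mul_vClosure_le _ _ (FractionalIdeal.mul_mem_mul (mem_spanSingleton_self R⁰ a) hx)⟩
  rw [coe_mul, coe_spanSingleton]
  exact (Submodule.fg_span_singleton a).mul hJ

theorem IsDivisorial.isTIdeal {I : FractionalIdeal R⁰ K} (h : IsDivisorial I) : IsTIdeal I :=
  ⟨h.1, le_antisymm ((tClosure_le_vClosure I).trans_eq h.2) (le_tClosure I)⟩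

theorem mul_one_div_le (I : FractionalIdeal R⁰ K) : I * (1 / I) ≤ 1 := by
  by_cases hI : I = 0
  · simp [hI]
  refine FractionalIdeal.mul_le.2 fun x hx y hy => ?_
  rw [mul_comm]
  exact (mem_one_div hI y).1 hy x hx

theorem eq_one_of_one_mem {I : FractionalIdeal R⁰ K} (hI : I ≤ 1) (h : (1 : K) ∈ I) : I = 1 :=
  le_antisymm hI (FractionalIdeal.one_le.2 h)

theorem tClosure_le_one {I : FractionalIdeal R⁰ K} (hI : I ≤ 1) : tClosure I ≤ 1 :=
  (tClosure_mono hI).trans_eq tClosure_one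

theorem isTIdeal_tClosure {I : FractionalIdeal R⁰ K} (hI : I ≠ 0) : IsTIdeal (tClosure I) :=
  ⟨ne_zero_of_le hI (le_tClosure I), tClosure_tClosure I⟩

theorem one_le_one_div {I : FractionalIdeal R⁰ K} (hI : I ≠ 0) (h : I ≤ 1) : 1 ≤ 1 / I := by
  rw [FractionalIdeal.one_le, mem_one_div hI]
  intro y hy
  rw [one_mul]
  exact h hy

/-- Zorn's lemma is applied to the ideals A with 1 ∉ A_t, not to `t`-ideals: membership of 1 is
witnessed by a finitely generated ideal, which already lies in a member of the chain. A maximal such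
A equals A_t. -/
theorem exists_le_isMaximalTIdeal {I : FractionalIdeal R⁰ K} (hI : I ≠ 0) (h1 : I ≤ 1)
    (ht : tClosure I ≠ 1) : ∃ M : FractionalIdeal R⁰ K, IsMaximalTIdeal M ∧ I ≤ M := by
  obtain ⟨I, rfl⟩ := le_one_iff_exists_coeIdeal.1 h1
  have hne : ∀ A : Ideal R, (1 : K) ∉ tClosure (A : FractionalIdeal R⁰ K) ↔
      tClosure (A : FractionalIdeal R⁰ K) ≠ 1 := fun A =>
    not_congr ⟨eq_one_of_one_mem (tClosure_le_one coeIdeal_le_one),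
      fun h => h ▸ FractionalIdeal.one_mem_one R⁰⟩
  obtain ⟨M, hIM, hM⟩ := zorn_le_nonempty₀
    {A : Ideal R | (1 : K) ∉ tClosure (A : FractionalIdeal R⁰ K)} (by
      intro c hc hchain A hA
      refine ⟨sSup c, ?_, fun B hB => le_sSup hB⟩
      rintro ⟨J, hJ, hJc, h1J⟩
      obtain ⟨J, rfl⟩ := le_one_iff_exists_coeIdeal.1 (hJc.trans coeIdeal_le_one)
      rw [coeIdeal_le_coeIdeal] at hJc
      have hJ' : J.FG := (coeIdeal_fg R⁰ (IsFractionRing.injective R K) J).1 hJ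
      obtain ⟨B, hB, hJB⟩ := (CompleteLattice.isCompactElement_iff_le_of_directed_sSup_le _ J).1
        ((Submodule.fg_iff_compact J).1 hJ') c ⟨A, hA⟩ hchain.directedOn hJc
      exact hc hB ⟨J, hJ, (coeIdeal_le_coeIdeal K).2 hJB, h1J⟩) I ((hne I).2 ht)
  have hM0 : (M : FractionalIdeal R⁰ K) ≠ 0 := ne_zero_of_le hI ((coeIdeal_le_coeIdeal K).2 hIM)
  have hMt : tClosure (M : FractionalIdeal R⁰ K) = M := by
    obtain ⟨B, hB⟩ := le_one_iff_exists_coeIdeal.1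
      (tClosure_le_one (I := (M : FractionalIdeal R⁰ K)) coeIdeal_le_one)
    have hMB : M ≤ B := by
      rw [← coeIdeal_le_coeIdeal K, hB]
      exact le_tClosure _
    have : B ≤ M := hM.2 (by
      change (1 : K) ∉ tClosure (B : FractionalIdeal R⁰ K)
      rw [hB, tClosure_tClosure]
      exact hM.1) hMB
    rw [← hB, le_antisymm this hMB]
  refine ⟨M, ⟨⟨⟨hM0, hMt⟩, coeIdeal_le_one, fun h => (hne M).1 hM.1 (hMt.trans h)⟩, ?_⟩,
    (coeIdeal_le_coeIdeal K).2 hIM⟩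
  rintro B ⟨hB, hB1, hB2⟩ hMB
  obtain ⟨B, rfl⟩ := le_one_iff_exists_coeIdeal.1 hB1
  rw [coeIdeal_le_coeIdeal] at hMB ⊢
  exact hM.2 ((hne B).2 (by rwa [hB.2])) hMB

end Closure

end StarIdeal

namespace StarIdeal

/-! ### Maximal `t`-ideals: primality, strength and `t`-invertibility. -/

section Maximal

variable {R : Type*} [CommRing R] [IsDomain R] {K : Type*} [Field K] [Algebra R K]
  [IsFractionRing R K]

open FractionalIdeal

variable {M : FractionalIdeal R⁰ K}

theorem IsMaximalTIdeal.ne_zero (hM : IsMaximalTIdeal M) : M ≠ 0 := hM.1.1.1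

theorem IsMaximalTIdeal.le_one (hM : IsMaximalTIdeal M) : M ≤ 1 := hM.1.2.1

theorem IsMaximalTIdeal.one_notMem (hM : IsMaximalTIdeal M) : (1 : K) ∉ M := fun h =>
  hM.1.2.2 (eq_one_of_one_mem hM.le_one h)

/-- An integral ideal containing a maximal `t`-ideal either is equal to it or has `t`-closure the
whole ring. -/
theorem IsMaximalTIdeal.tClosure_eq_one (hM : IsMaximalTIdeal M) {A : FractionalIdeal R⁰ K}
    (hMA : M ≤ A) (hA : A ≤ 1) (h : ¬ A ≤ M) : tClosure A = 1 := by
  by_contra h1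
  exact h ((le_tClosure A).trans (hM.2 ⟨isTIdeal_tClosure (ne_zero_of_le hM.ne_zero hMA),
    tClosure_le_one hA, h1⟩ (hMA.trans (le_tClosure A))))

/-- If x ∉ M then (M + xR)_t = R; multiplying by y gives yR ⊆ (yM + xyR)_t ⊆ M. -/
theorem IsMaximalTIdeal.mem_or_mem (hM : IsMaximalTIdeal M) {x y : K}
    (hx : x ∈ (1 : FractionalIdeal R⁰ K)) (hy : y ∈ (1 : FractionalIdeal R⁰ K))
    (hxy : x * y ∈ M) : x ∈ M ∨ y ∈ M := by
  by_contra! h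
  have h1 : tClosure (M ⊔ spanSingleton R⁰ x) = 1 :=
    hM.tClosure_eq_one le_sup_left (sup_le hM.le_one (spanSingleton_le_iff_mem.2 hx)) fun h' =>
      h.1 (h' (show x ∈ M ⊔ spanSingleton R⁰ x from
        (le_sup_right : spanSingleton R⁰ x ≤ M ⊔ spanSingleton R⁰ x) (mem_spanSingleton_self R⁰ x)))
  have h2 : spanSingleton R⁰ y * (M ⊔ spanSingleton R⁰ x) ≤ M := by
    rw [sup_eq_add, mul_add, ← sup_eq_add, spanSingleton_mul_spanSingleton]
    refine sup_le ?_ (spanSingleton_le_iff_mem.2 (by rwa [mul_comm]))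
    exact (mul_le_mul' (spanSingleton_le_iff_mem.2 hy) le_rfl).trans_eq (one_mul M)
  have h3 := (mul_tClosure_le (spanSingleton R⁰ y) (M ⊔ spanSingleton R⁰ x)).trans
    ((tClosure_mono h2).trans_eq hM.1.1.2)
  rw [h1, mul_one, spanSingleton_le_iff_mem] at h3
  exact h.2 h3

theorem IsMaximalTIdeal.isPrimeIdeal (hM : IsMaximalTIdeal M) : IsPrimeIdeal M := by
  obtain ⟨P, rfl⟩ := le_one_iff_exists_coeIdeal.1 hM.le_one
  have hmem : ∀ r : R, algebraMap R K r ∈ (P : FractionalIdeal R⁰ K) ↔ r ∈ P := fun r =>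
    ⟨fun h => by
      obtain ⟨s, hs, h⟩ := (mem_coeIdeal R⁰).1 h
      rwa [← IsFractionRing.injective R K h], fun h => mem_coeIdeal_of_mem R⁰ h⟩
  refine ⟨P, ⟨?_, fun {x y} hxy => ?_⟩, rfl⟩
  · rintro rfl
    exact hM.1.2.2 (by simp)
  · rw [← hmem, ← hmem]
    refine hM.mem_or_mem (coe_mem_one R⁰ x) (coe_mem_one R⁰ y) ?_
    rw [← map_mul, hmem]
    exact hxy

theorem IsPrimeIdeal.isProper {P : FractionalIdeal R⁰ K} (hP : IsPrimeIdeal P) : IsProper P := by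
  obtain ⟨P, hP, rfl⟩ := hP
  refine ⟨coeIdeal_le_one, fun h => hP.ne_top ?_⟩
  exact coeIdeal_injective (K := K) (by simpa using h)

theorem mul_one_div_le_iff {I : FractionalIdeal R⁰ K} (hI : I ≠ 0) (h1 : I ≤ 1) :
    I * (1 / I) ≤ I ↔ IsStrong I := by
  constructor
  · refine fun h => ⟨hI, le_antisymm ?_ ?_⟩
    · intro x hx
      rw [mem_colon hI]
      intro y hy
      rw [mul_comm]
      exact h (FractionalIdeal.mul_mem_mul hy hx)
    · intro x hx
      change x ∈ I / I at hx
      rw [mem_colon hI] at hx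
      exact (mem_one_div hI x).2 fun y hy => h1 (hx y hy)
  · rintro ⟨-, h⟩
    rw [h]
    refine FractionalIdeal.mul_le.2 fun x hx y hy => ?_
    rw [mul_comm]
    exact (mem_colon hI I y).1 hy x hx

theorem IsMaximalTIdeal.isTInvertible (hM : IsMaximalTIdeal M) (h : ¬ IsStrong M) :
    IsTInvertible M := by
  refine ⟨hM.ne_zero, hM.tClosure_eq_one ?_ (mul_one_div_le M) ?_⟩
  · exact (mul_one M).symm.trans_le (mul_le_mul' le_rfl (one_le_one_div hM.ne_zero hM.le_one))
  · rwa [mul_one_div_le_iff hM.ne_zero hM.le_one]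

/-- Multiply (I(R:I))_t = R by I_v and use I_v(R:I) ⊆ R, since I and I_v have the same inverse. -/
theorem IsTInvertible.isDivisorial {I : FractionalIdeal R⁰ K} (h : IsTInvertible I)
    (ht : IsTIdeal I) : IsDivisorial I := by
  refine ⟨ht.1, le_antisymm ?_ (le_vClosure I)⟩
  have h1 : vClosure I * (1 / I) ≤ 1 := by
    have := mul_one_div_le (vClosure I)
    rwa [one_div_vClosure ht.1] at this
  calc vClosure I = vClosure I * tClosure (I * (1 / I)) := by rw [h.2, mul_one]
    _ ≤ tClosure (vClosure I * (I * (1 / I))) := mul_tClosure_le _ _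
    _ = tClosure (I * (vClosure I * (1 / I))) := by rw [mul_left_comm]
    _ ≤ tClosure I := tClosure_mono ((mul_le_mul' le_rfl h1).trans_eq (mul_one I))
    _ = I := ht.2

theorem IsTInvertible.not_isStrong {I : FractionalIdeal R⁰ K} (h : IsTInvertible I)
    (ht : IsTIdeal I) (hI : IsProper I) : ¬ IsStrong I := by
  rw [← mul_one_div_le_iff ht.1 hI.1]
  intro h1
  have h2 := tClosure_mono h1
  rw [h.2, ht.2] at h2
  exact hI.2 (le_antisymm hI.1 h2)

/-- In a completely integrally closed domain, `(A : A) = R` for each nonzero fractional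
ideal `A`. -/
theorem IsCompletelyIntegrallyClosed.div_self_le (h : IsCompletelyIntegrallyClosed R K)
    {A : FractionalIdeal R⁰ K} (hA : A ≠ 0) : A / A ≤ 1 := by
  intro x hx
  change x ∈ A / A at hx
  rw [mem_colon hA] at hx
  obtain ⟨y, hy, hy0⟩ := exists_mem_ne_zero hA
  obtain ⟨a, ha, haA⟩ := A.isFractional
  obtain ⟨b, c, hc, rfl⟩ := IsFractionRing.div_surjective (A := R) y
  have hb : b ≠ 0 := by
    rintro rfl
    simp at hy0
  have hpow : ∀ n : ℕ, x ^ n * (algebraMap R K b / algebraMap R K c) ∈ A := by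
    intro n
    induction n with
    | zero => simpa using hy
    | succ n ih =>
      rw [pow_succ', mul_assoc]
      exact hx _ ih
  have hmem : x ∈ completeIntegralClosure R K := by
    -- Here a clears denominators in A and b is the numerator of the chosen b/c ∈ A, so ab·x^n =
    -- c·(a·x^n·b/c) lies in R.
    refine ⟨a * b, mul_mem ha (mem_nonZeroDivisors_of_ne_zero hb), fun n => ?_⟩
    obtain ⟨r, hr⟩ := haA _ (hpow n)
    refine ⟨c * r, ?_⟩
    have hc' : algebraMap R K c ≠ 0 := by
      simpa using nonZeroDivisors.ne_zero hc
    rw [map_mul, hr, Algebra.smul_def, Algebra.smul_def, map_mul]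
    field_simp
  rw [h] at hmem
  obtain ⟨r, rfl⟩ := Algebra.mem_bot.1 hmem
  exact coe_mem_one R⁰ r

theorem IsCompletelyIntegrallyClosed.not_isStronglyDivisorial
    (h : IsCompletelyIntegrallyClosed R K) {P : FractionalIdeal R⁰ K} (hP : IsProper P) :
    ¬ IsStronglyDivisorial P := by
  rintro ⟨⟨hP0, hs⟩, -, hd⟩
  have h1 : 1 / P = 1 :=
    le_antisymm (hs.trans_le (h.div_self_le hP0)) (one_le_one_div hP0 hP.1)
  rw [vClosure, h1, FractionalIdeal.div_one] at hd
  exact hP.2 hd.symm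

end Maximal

end StarIdeal

namespace StarIdeal

/-! ### Order at a maximal `t`-ideal, and its localization as a discrete valuation ring. -/

section Local

variable {R : Type*} [CommRing R] [IsDomain R] {K : Type*} [Field K] [Algebra R K]
  [IsFractionRing R K]

open FractionalIdeal

variable {M : FractionalIdeal R⁰ K}

theorem mul_mem_of_mem_one {I : FractionalIdeal R⁰ K} {x y : K}
    (hx : x ∈ (1 : FractionalIdeal R⁰ K)) (hy : y ∈ I) : x * y ∈ I := by
  have := FractionalIdeal.mul_mem_mul hx hy
  rwa [one_mul] at this

theorem pow_mem_pow' {I : FractionalIdeal R⁰ K} {x : K} (hx : x ∈ I) (n : ℕ) :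
    x ^ n ∈ I ^ n := by
  induction n with
  | zero => simp
  | succ n ih =>
    rw [pow_succ, pow_succ]
    exact FractionalIdeal.mul_mem_mul ih hx

theorem pow_mem_one {x : K} (hx : x ∈ (1 : FractionalIdeal R⁰ K)) (n : ℕ) :
    x ^ n ∈ (1 : FractionalIdeal R⁰ K) := by
  have := pow_mem_pow' hx n
  rwa [one_pow] at this

theorem spanSingleton_mul_le_iff {A B : FractionalIdeal R⁰ K} {x : K} :
    spanSingleton R⁰ x * A ≤ B ↔ ∀ y ∈ A, x * y ∈ B := by
  refine ⟨fun h y hy => h (FractionalIdeal.mul_mem_mul (mem_spanSingleton_self R⁰ x) hy),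
    fun h z hz => ?_⟩
  obtain ⟨y, hy, rfl⟩ := mem_singleton_mul.1 hz
  exact h y hy

theorem IsDivisorial.mem_iff (hd : IsDivisorial M) {x : K} :
    x ∈ M ↔ ∀ y ∈ 1 / M, x * y ∈ (1 : FractionalIdeal R⁰ K) := by
  conv_lhs => rw [← hd.2]
  exact mem_one_div (one_div_ne_zero' hd.1) x

theorem IsMaximalTIdeal.mul_notMem (hM : IsMaximalTIdeal M) {x y : K}
    (hx : x ∈ (1 : FractionalIdeal R⁰ K)) (hy : y ∈ (1 : FractionalIdeal R⁰ K))
    (hxM : x ∉ M) (hyM : y ∉ M) : x * y ∉ M := fun h =>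
  (hM.mem_or_mem hx hy h).elim hxM hyM

theorem IsMaximalTIdeal.pow_notMem (hM : IsMaximalTIdeal M) {x : K}
    (hx : x ∈ (1 : FractionalIdeal R⁰ K)) (hxM : x ∉ M) (n : ℕ) : x ^ n ∉ M := by
  induction n with
  | zero => simpa using hM.one_notMem
  | succ n ih =>
    rw [pow_succ]
    exact hM.mul_notMem (pow_mem_one hx n) hx ih hxM

/-- If `x` lies in `R` but not in all the residuals `(R : (R : M)^n)`, then it has a
well-defined order at `M`. -/
theorem exists_pow_le_one_and_notMem {x : K} (hx : x ∈ (1 : FractionalIdeal R⁰ K))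
    (h : ¬ ∀ n : ℕ, spanSingleton R⁰ x * (1 / M) ^ n ≤ 1) :
    ∃ n : ℕ, spanSingleton R⁰ x * (1 / M) ^ n ≤ 1 ∧ ∃ y ∈ (1 / M) ^ n, x * y ∉ M := by
  by_contra! hc
  -- If x(R:M)^n ⊆ R always forces x(R:M)^n ⊆ M, then x(R:M)^(n+1) ⊆ M(R:M) ⊆ R, and induction
  -- covers every n.
  refine h fun n => ?_
  induction n with
  | zero => simpa [spanSingleton_le_iff_mem] using hx
  | succ n ih =>
    rw [pow_succ, ← mul_assoc]
    exact (mul_le_mul' (spanSingleton_mul_le_iff.2 (hc n ih)) le_rfl).trans (mul_one_div_le M)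

/-- The intersection of the residuals `(R : (R : M)^n)`. -/
def powResidual (M : FractionalIdeal R⁰ K) : Ideal R where
  carrier := {r | ∀ n : ℕ, ∀ y ∈ (1 / M) ^ n, algebraMap R K r * y ∈ (1 : FractionalIdeal R⁰ K)}
  zero_mem' := fun n y _ => by
    rw [map_zero, zero_mul]
    exact (1 : FractionalIdeal R⁰ K).coeToSubmodule.zero_mem
  add_mem' := fun {a b} ha hb n y hy => by
    rw [map_add, add_mul]
    exact (1 : FractionalIdeal R⁰ K).coeToSubmodule.add_mem (ha n y hy) (hb n y hy)
  smul_mem' := fun c r hr n y hy => by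
    rw [smul_eq_mul, map_mul, mul_assoc]
    exact mul_mem_of_mem_one (coe_mem_one R⁰ c) (hr n y hy)

theorem mem_powResidual {x : K} : x ∈ (powResidual M : FractionalIdeal R⁰ K) ↔
    ∀ n : ℕ, spanSingleton R⁰ x * (1 / M) ^ n ≤ 1 := by
  simp only [spanSingleton_mul_le_iff]
  constructor
  · intro h
    obtain ⟨r, hr, rfl⟩ := (mem_coeIdeal R⁰).1 h
    exact hr
  · intro h
    have h1 := h 0 1 (by simp)
    obtain ⟨r, hr⟩ := (mem_one_iff R⁰).1 h1
    rw [mul_one] at hr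
    subst hr
    exact mem_coeIdeal_of_mem R⁰ h

theorem algebraMap_mem_coeIdeal {I : Ideal R} {r : R} :
    algebraMap R K r ∈ (I : FractionalIdeal R⁰ K) ↔ r ∈ I := by
  refine ⟨fun h => ?_, fun h => mem_coeIdeal_of_mem R⁰ h⟩
  obtain ⟨s, hs, h⟩ := (mem_coeIdeal R⁰).1 h
  rwa [← IsFractionRing.injective R K h]

/-- Finite orders add: M is prime, so if ay and bz are outside M then so is abyz. -/
theorem powResidual_isPrime (hM : IsMaximalTIdeal M) (hd : IsDivisorial M) :
    (powResidual M).IsPrime := by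
  constructor
  · intro h
    have h1 : (1 : K) ∈ (powResidual M : FractionalIdeal R⁰ K) := by
      rw [h, coeIdeal_top]
      exact FractionalIdeal.one_mem_one R⁰
    have h2 := mem_powResidual.1 h1 1
    rw [spanSingleton_one, one_mul, pow_one] at h2
    refine hM.one_notMem (hd.mem_iff.2 fun y hy => ?_)
    rw [one_mul]
    exact h2 hy
  · intro a b hab
    rw [← algebraMap_mem_coeIdeal (K := K), mem_powResidual] at hab
    rw [← algebraMap_mem_coeIdeal (K := K), ← algebraMap_mem_coeIdeal (K := K) (r := b),
      mem_powResidual, mem_powResidual]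
    by_contra! hc
    rw [← not_forall, ← not_forall] at hc
    obtain ⟨n, hn, y, hy, hyM⟩ := exists_pow_le_one_and_notMem (coe_mem_one R⁰ a) hc.1
    obtain ⟨m, hm, z, hz, hzM⟩ := exists_pow_le_one_and_notMem (coe_mem_one R⁰ b) hc.2
    refine hM.mul_notMem (spanSingleton_mul_le_iff.1 hn y hy)
      (spanSingleton_mul_le_iff.1 hm z hz) hyM hzM (hd.mem_iff.2 fun w hw => ?_)
    -- The extra factor w ∈ (R:M) turns membership in R into membership in M, by divisoriality.
    have := spanSingleton_mul_le_iff.1 (hab (n + m + 1)) (y * z * w) (by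
      rw [pow_succ, pow_add]
      exact FractionalIdeal.mul_mem_mul (FractionalIdeal.mul_mem_mul hy hz) hw)
    rw [map_mul] at this
    convert this using 1
    ring

/-- The ideal is stable under multiplication by every (R:M)^n. Hence its inverse contains all these
powers, which gives divisoriality, and stability also lets its trace satisfy the defining condition.
-/
theorem powResidual_isStronglyDivisorial
    (h0 : (powResidual M : FractionalIdeal R⁰ K) ≠ 0) :
    IsStronglyDivisorial (powResidual M : FractionalIdeal R⁰ K) := by
  have hmul : ∀ n : ℕ, ∀ y ∈ (1 / M) ^ n, ∀ x ∈ (powResidual M : FractionalIdeal R⁰ K),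
      y * x ∈ (powResidual M : FractionalIdeal R⁰ K) := by
    intro n y hy x hx
    rw [mem_powResidual] at hx ⊢
    simp only [spanSingleton_mul_le_iff] at hx ⊢
    intro m z hz
    have := hx (n + m) (y * z) (by
      rw [pow_add]
      exact FractionalIdeal.mul_mem_mul hy hz)
    convert this using 1
    ring
  refine ⟨?_, h0, le_antisymm ?_ (le_vClosure _)⟩
  · rw [← mul_one_div_le_iff h0 coeIdeal_le_one]
    refine FractionalIdeal.mul_le.2 fun x hx y hy => ?_
    rw [mem_powResidual]
    simp only [spanSingleton_mul_le_iff]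
    intro n z hz
    have := (mem_one_div h0 y).1 hy _ (hmul n z hz x hx)
    convert this using 1
    ring
  · intro x hx
    have hx' := (mem_one_div (one_div_ne_zero' h0) x).1 hx
    change x ∈ (powResidual M : FractionalIdeal R⁰ K)
    rw [mem_powResidual]
    simp only [spanSingleton_mul_le_iff]
    exact fun n y hy => hx' y ((mem_one_div h0 y).2 fun z hz =>
      coeIdeal_le_one (hmul n y hy z hz))

variable (M) in
/-- Each nonzero element of `R` has a finite order at `M`. -/
def IsArchimedean : Prop :=
  ∀ x ∈ (1 : FractionalIdeal R⁰ K), x ≠ 0 →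
    ∃ n : ℕ, spanSingleton R⁰ x * (1 / M) ^ n ≤ 1 ∧ ∃ y ∈ (1 / M) ^ n, x * y ∉ M

theorem isArchimedean_of_no_stronglyDivisorial_prime
    (h : ¬ ∃ P : FractionalIdeal R⁰ K, IsPrimeIdeal P ∧ IsStronglyDivisorial P)
    (hM : IsMaximalTIdeal M) (hd : IsDivisorial M) : IsArchimedean M := by
  refine fun x hx hx0 => exists_pow_le_one_and_notMem hx fun hc => h ?_
  exact ⟨powResidual M, ⟨powResidual M, powResidual_isPrime hM hd, rfl⟩,
    powResidual_isStronglyDivisorial (ne_zero_of_mem (mem_powResidual.2 hc) hx0)⟩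

theorem exists_mul_notMem_of_not_isStrong (hM : IsMaximalTIdeal M) (hs : ¬ IsStrong M) :
    ∃ p ∈ M, ∃ l ∈ 1 / M, p * l ∈ (1 : FractionalIdeal R⁰ K) ∧ p * l ∉ M := by
  rw [← mul_one_div_le_iff hM.ne_zero hM.le_one, FractionalIdeal.mul_le] at hs
  push Not at hs
  obtain ⟨p, hp, l, hl, h⟩ := hs
  exact ⟨p, hp, l, hl, mul_one_div_le M (FractionalIdeal.mul_mem_mul hp hl), h⟩

/-- The single element l computes the order: if xl^n ∈ M, multiplying by p^n y ∈ R puts (xy)(pl)^n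
in M, although neither xy nor pl is there. -/
theorem IsArchimedean.exists_mul_pow_notMem (ha : IsArchimedean M) (hM : IsMaximalTIdeal M)
    {p l : K} (hp : p ∈ M) (hl : l ∈ 1 / M) (hpl : p * l ∉ M) {x : K}
    (hx : x ∈ (1 : FractionalIdeal R⁰ K)) (hx0 : x ≠ 0) :
    ∃ n : ℕ, x * l ^ n ∈ (1 : FractionalIdeal R⁰ K) ∧ x * l ^ n ∉ M := by
  obtain ⟨n, hn, y, hy, hyM⟩ := ha x hx hx0
  have hu : p * l ∈ (1 : FractionalIdeal R⁰ K) :=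
    mul_one_div_le M (FractionalIdeal.mul_mem_mul hp hl)
  rw [spanSingleton_mul_le_iff] at hn
  refine ⟨n, hn _ (pow_mem_pow' hl n), fun h => ?_⟩
  have h1 : p ^ n * y ∈ (1 : FractionalIdeal R⁰ K) := by
    have h2 := FractionalIdeal.mul_mem_mul (pow_mem_pow' hp n) hy
    rw [← mul_pow] at h2
    exact (pow_le_one' (mul_one_div_le M) n) h2
  refine hM.mul_notMem (hn y hy) (pow_mem_one hu n) hyM (hM.pow_notMem hu hpl n) ?_
  have := mul_mem_of_mem_one h1 h
  convert this using 1
  rw [mul_pow]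
  ring

variable (M) in
/-- The valuation ring `V` is the localization of `R` at `M`. -/
def IsLocalRingAt (V : ValuationSubring K) : Prop :=
  ∀ x : K, x ∈ V ↔ ∃ s ∈ (1 : FractionalIdeal R⁰ K), s ∉ M ∧ s * x ∈ (1 : FractionalIdeal R⁰ K)

theorem IsArchimedean.exists_isLocalRingAt (ha : IsArchimedean M) (hM : IsMaximalTIdeal M)
    (hs : ¬ IsStrong M) : ∃ V : ValuationSubring K, IsLocalRingAt M V := by
  obtain ⟨p, hp, l, hl, hu, huM⟩ := exists_mul_notMem_of_not_isStrong hM hs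
  have h1 := FractionalIdeal.one_mem_one (P := K) R⁰
  have key : ∀ a b : K, a ∈ (1 : FractionalIdeal R⁰ K) → b ≠ 0 → ∀ n m : ℕ, m ≤ n →
      a * l ^ n ∈ (1 : FractionalIdeal R⁰ K) → b * l ^ m ∈ (1 : FractionalIdeal R⁰ K) →
      b * l ^ m ∉ M → ∃ s ∈ (1 : FractionalIdeal R⁰ K), s ∉ M ∧
        s * (a / b) ∈ (1 : FractionalIdeal R⁰ K) := by
    intro a b ha1 hb0 n m hmn han hbm hbM
    obtain ⟨k, rfl⟩ := Nat.exists_eq_add_of_le hmn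
    -- With n = m + k, this denominator carries a/b to p^k·(a·l^n).
    refine ⟨b * l ^ m * (p * l) ^ k, mul_mem_of_mem_one hbm (pow_mem_one hu k),
      hM.mul_notMem hbm (pow_mem_one hu k) hbM (hM.pow_notMem hu huM k), ?_⟩
    have := mul_mem_of_mem_one (pow_mem_one (hM.le_one hp) k) han
    convert this using 1
    rw [mul_pow, pow_add]
    field_simp
  refine ⟨{
    carrier := {x | ∃ s ∈ (1 : FractionalIdeal R⁰ K), s ∉ M ∧
      s * x ∈ (1 : FractionalIdeal R⁰ K)}
    mul_mem' := ?_
    one_mem' := ⟨1, h1, hM.one_notMem, by rwa [mul_one]⟩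
    add_mem' := ?_
    zero_mem' := ⟨1, h1, hM.one_notMem, by
      rw [mul_zero]
      exact (1 : FractionalIdeal R⁰ K).coeToSubmodule.zero_mem⟩
    neg_mem' := ?_
    mem_or_inv_mem' := ?_ }, fun x => Iff.rfl⟩
  · rintro x y ⟨s, hs, hsM, hsx⟩ ⟨t, ht, htM, hty⟩
    refine ⟨s * t, mul_mem_of_mem_one hs ht, hM.mul_notMem hs ht hsM htM, ?_⟩
    rw [mul_mul_mul_comm]
    exact mul_mem_of_mem_one hsx hty
  · rintro x y ⟨s, hs, hsM, hsx⟩ ⟨t, ht, htM, hty⟩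
    refine ⟨s * t, mul_mem_of_mem_one hs ht, hM.mul_notMem hs ht hsM htM, ?_⟩
    rw [show s * t * (x + y) = t * (s * x) + s * (t * y) by ring]
    exact (1 : FractionalIdeal R⁰ K).coeToSubmodule.add_mem (mul_mem_of_mem_one ht hsx)
      (mul_mem_of_mem_one hs hty)
  · rintro x ⟨s, hs, hsM, hsx⟩
    refine ⟨s, hs, hsM, ?_⟩
    rw [mul_neg]
    exact (1 : FractionalIdeal R⁰ K).coeToSubmodule.neg_mem hsx
  · intro x
    by_cases hx : x = 0
    · left
      refine ⟨1, h1, hM.one_notMem, ?_⟩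
      rw [hx, mul_zero]
      exact (1 : FractionalIdeal R⁰ K).coeToSubmodule.zero_mem
    obtain ⟨a, b, hb, rfl⟩ := IsFractionRing.div_surjective (A := R) x
    obtain ⟨ha0, hb0⟩ := div_ne_zero_iff.1 hx
    obtain ⟨n, hn, hnM⟩ := ha.exists_mul_pow_notMem hM hp hl huM (coe_mem_one R⁰ a) ha0
    obtain ⟨m, hm, hmM⟩ := ha.exists_mul_pow_notMem hM hp hl huM (coe_mem_one R⁰ b) hb0
    rcases le_total m n with hmn | hmn
    · exact Or.inl (key _ _ (coe_mem_one R⁰ a) hb0 n m hmn hn hm hmM)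
    · right
      rw [inv_div]
      exact key _ _ (coe_mem_one R⁰ b) ha0 m n hmn hm hn hnM

theorem isDiscreteValuationRing_of_associated_pow {A : Type*} [CommRing A] [IsDomain A] {ϖ : A}
    (h0 : ϖ ≠ 0) (h1 : ¬ IsUnit ϖ) (h : ∀ x : A, x ≠ 0 → ∃ n : ℕ, Associated (ϖ ^ n) x) :
    IsDiscreteValuationRing A := by
  have hdvd : ∀ x : A, x ≠ 0 → ¬ IsUnit x → ϖ ∣ x := by
    intro x hx hxu
    obtain ⟨n, hn⟩ := h x hx
    rcases n with _ | n
    · rw [pow_zero] at hn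
      exact absurd (hn.isUnit isUnit_one) hxu
    · exact (dvd_pow_self ϖ n.succ_ne_zero).trans hn.dvd
  refine IsDiscreteValuationRing.ofHasUnitMulPowIrreducibleFactorization
    ⟨ϖ, ⟨h1, fun a b hab => ?_⟩, fun {x} hx => h x hx⟩
  by_contra! hc
  have hab0 : a * b ≠ 0 := hab ▸ h0
  obtain ⟨c, rfl⟩ := hdvd a (left_ne_zero_of_mul hab0) hc.1
  obtain ⟨d, rfl⟩ := hdvd b (right_ne_zero_of_mul hab0) hc.2
  refine h1 (IsUnit.of_mul_eq_one (c * d) (mul_left_cancel₀ h0 ?_))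
  rw [mul_one]
  nth_rewrite 3 [hab]
  ring

theorem IsArchimedean.isDiscreteValuationRing (ha : IsArchimedean M) (hM : IsMaximalTIdeal M)
    (hs : ¬ IsStrong M) {V : ValuationSubring K} (hV : IsLocalRingAt M V) :
    IsDiscreteValuationRing V := by
  obtain ⟨p, hp, l, hl, hu, huM⟩ := exists_mul_notMem_of_not_isStrong hM hs
  have h0M : (0 : K) ∈ M := M.coeToSubmodule.zero_mem
  have hu0 : p * l ≠ 0 := fun h => huM (h ▸ h0M)
  have hl0 : l ≠ 0 := right_ne_zero_of_mul hu0
  have hlV : l⁻¹ ∈ V := (hV _).2 ⟨p * l, hu, huM, by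
    rw [mul_assoc, mul_inv_cancel₀ hl0, mul_one]
    exact hM.le_one hp⟩
  refine isDiscreteValuationRing_of_associated_pow (ϖ := (⟨l⁻¹, hlV⟩ : V)) ?_ ?_ ?_
  · exact fun h => inv_ne_zero hl0 (congrArg Subtype.val h)
  · intro h
    obtain ⟨⟨y, hy⟩, hy1⟩ := h.exists_right_inv
    have hyl : l⁻¹ * y = 1 := congrArg Subtype.val hy1
    obtain rfl : y = l := by
      field_simp at hyl
      exact hyl
    obtain ⟨s, hs, hsM, hsl⟩ := (hV y).1 hy
    -- If l were in the localization, with sl ∈ R, then s(pl) = (sl)p would lie in M.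
    refine hM.mul_notMem hs hu hsM huM ?_
    have := mul_mem_of_mem_one hsl hp
    convert this using 1
    ring
  · rintro ⟨x, hx⟩ hx0
    have hx0' : x ≠ 0 := fun h => hx0 (Subtype.ext h)
    obtain ⟨s, hs, hsM, hsx⟩ := (hV x).1 hx
    have hs0 : s ≠ 0 := fun h => hsM (h ▸ h0M)
    obtain ⟨n, hn, hnM⟩ := ha.exists_mul_pow_notMem hM hp hl huM hsx (mul_ne_zero hs0 hx0')
    -- Factor x as l⁻ⁿ times xlⁿ, a unit because sxlⁿ and s both lie in R outside M.
    refine ⟨n, Units.mk ⟨x * l ^ n, (hV _).2 ⟨s, hs, hsM, by rwa [← mul_assoc]⟩⟩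
      ⟨(x * l ^ n)⁻¹, (hV _).2 ⟨s * x * l ^ n, hn, hnM, ?_⟩⟩ ?_ ?_, ?_⟩
    · rw [mul_assoc s, mul_assoc, mul_inv_cancel₀ (mul_ne_zero hx0' (pow_ne_zero n hl0)), mul_one]
      exact hs
    · exact Subtype.ext (mul_inv_cancel₀ (mul_ne_zero hx0' (pow_ne_zero n hl0)))
    · exact Subtype.ext (inv_mul_cancel₀ (mul_ne_zero hx0' (pow_ne_zero n hl0)))
    · refine Subtype.ext ?_
      change l⁻¹ ^ n * (x * l ^ n) = x
      rw [inv_pow, mul_comm, mul_assoc, mul_inv_cancel₀ (pow_ne_zero n hl0), mul_one]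

/-- The conductor (R : R + xR) is divisorial, hence a `t`-ideal; each s puts it outside the
corresponding M, so it is R. -/
theorem mem_one_of_forall_isMaximalTIdeal {x : K}
    (h : ∀ M : FractionalIdeal R⁰ K, IsMaximalTIdeal M →
      ∃ s ∈ (1 : FractionalIdeal R⁰ K), s ∉ M ∧ s * x ∈ (1 : FractionalIdeal R⁰ K)) :
    x ∈ (1 : FractionalIdeal R⁰ K) := by
  have h1 := FractionalIdeal.one_mem_one (P := K) R⁰
  have hle : 1 ≤ 1 ⊔ spanSingleton R⁰ x := le_sup_left
  have hne : 1 ⊔ spanSingleton R⁰ x ≠ 0 := ne_zero_of_mem (hle h1) one_ne_zero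
  have hD := isDivisorial_one_div hne
  have hD1 : 1 / (1 ⊔ spanSingleton R⁰ x) ≤ 1 := by
    have := one_div_antitone (ne_zero_of_mem h1 one_ne_zero) hle
    rwa [FractionalIdeal.div_one] at this
  have hD2 : 1 / (1 ⊔ spanSingleton R⁰ x) = 1 := by
    by_contra hc
    obtain ⟨M, hM, hDM⟩ := exists_le_isMaximalTIdeal hD.1 hD1 (by rwa [hD.isTIdeal.2])
    obtain ⟨s, hs, hsM, hsx⟩ := h M hM
    refine hsM (hDM ((mem_one_div hne s).2 ?_))
    rw [← spanSingleton_mul_le_iff, sup_eq_add, mul_add, mul_one, ← sup_eq_add,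
      spanSingleton_mul_spanSingleton]
    exact sup_le (spanSingleton_le_iff_mem.2 hs) (spanSingleton_le_iff_mem.2 hsx)
  rw [← hD2] at h1
  have h2 := (mem_one_div hne 1).1 h1 x
    ((le_sup_right : spanSingleton R⁰ x ≤ 1 ⊔ spanSingleton R⁰ x) (mem_spanSingleton_self R⁰ x))
  rwa [one_mul] at h2

end Local

end StarIdeal

namespace StarIdeal

/-! ### Finite character and the Krull property. -/

section Krull

variable {R : Type*} [CommRing R] [IsDomain R] {K : Type*} [Field K] [Algebra R K]
  [IsFractionRing R K]

open FractionalIdeal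

variable {M : FractionalIdeal R⁰ K}

variable (R K) in
/-- The products of maximal `t`-ideals. -/
def maximalTIdealProducts : Submonoid (FractionalIdeal R⁰ K) :=
  Submonoid.closure {M | IsMaximalTIdeal M}

theorem le_one_of_mem_maximalTIdealProducts {N : FractionalIdeal R⁰ K}
    (hN : N ∈ maximalTIdealProducts R K) : N ≤ 1 := by
  induction hN using Submonoid.closure_induction with
  | mem M hM => exact IsMaximalTIdeal.le_one hM
  | one => exact le_rfl
  | mul A B _ _ hA hB => exact mul_le_one' hA hB

/-- By primality a maximal `t`-ideal over a product contains, hence equals, one of the factors. -/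
theorem finite_setOf_le_of_mem_maximalTIdealProducts {N : FractionalIdeal R⁰ K}
    (hN : N ∈ maximalTIdealProducts R K) :
    {M : FractionalIdeal R⁰ K | IsMaximalTIdeal M ∧ N ≤ M}.Finite := by
  induction hN using Submonoid.closure_induction with
  | mem A hA =>
    refine (Set.finite_singleton A).subset ?_
    rintro M ⟨hM, hAM⟩
    have hA' : IsMaximalTIdeal A := hA
    exact le_antisymm (hA'.2 hM.1 hAM) hAM
  | one =>
    refine Set.finite_empty.subset ?_
    rintro M ⟨hM, h1⟩
    exact hM.one_notMem (h1 (FractionalIdeal.one_mem_one R⁰))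
  | mul A B hA hB ihA ihB =>
    refine (ihA.union ihB).subset ?_
    rintro M ⟨hM, hAB⟩
    by_contra hc
    simp only [Set.mem_union, Set.mem_ofPred_eq, hM, true_and, not_or] at hc
    obtain ⟨x, hx, hxM⟩ := SetLike.not_le_iff_exists.1 hc.1
    obtain ⟨y, hy, hyM⟩ := SetLike.not_le_iff_exists.1 hc.2
    exact hM.mul_notMem (le_one_of_mem_maximalTIdealProducts hA hx)
      (le_one_of_mem_maximalTIdealProducts hB hy) hxM hyM
      (hAB (FractionalIdeal.mul_mem_mul hx hy))

theorem vClosure_spanSingleton (x : K) :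
    vClosure (spanSingleton R⁰ x) = spanSingleton R⁰ x := by
  rw [vClosure, one_div_spanSingleton, one_div_spanSingleton, inv_inv]

/-- The ideal of the `r ∈ R` such that `r N ⊆ x R` for some product `N` of maximal `t`-ideals. -/
def productResidual (x : K) : Ideal R where
  carrier := {r | ∃ N ∈ maximalTIdealProducts R K,
    spanSingleton R⁰ (algebraMap R K r) * N ≤ spanSingleton R⁰ x}
  zero_mem' := ⟨1, one_mem _, by simp⟩
  add_mem' := by
    rintro a b ⟨A, hA, hAx⟩ ⟨B, hB, hBx⟩
    refine ⟨A * B, mul_mem hA hB, ?_⟩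
    rw [spanSingleton_mul_le_iff] at hAx hBx ⊢
    intro y hy
    have hyA : y ∈ A := by
      have := mul_le_mul' (le_refl A) (le_one_of_mem_maximalTIdealProducts hB) hy
      rwa [mul_one] at this
    have hyB : y ∈ B := by
      have := mul_le_mul' (le_one_of_mem_maximalTIdealProducts hA) (le_refl B) hy
      rwa [one_mul] at this
    rw [map_add, add_mul]
    exact (spanSingleton R⁰ x).coeToSubmodule.add_mem (hAx y hyA) (hBx y hyB)
  smul_mem' := by
    rintro c r ⟨N, hN, hNx⟩
    refine ⟨N, hN, ?_⟩
    rw [spanSingleton_mul_le_iff] at hNx ⊢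
    intro y hy
    rw [smul_eq_mul, map_mul, mul_assoc]
    exact mul_mem_of_mem_one (coe_mem_one R⁰ c) (hNx y hy)

theorem mem_productResidual {x y : K} (hx : x ∈ (1 : FractionalIdeal R⁰ K)) :
    x ∈ (productResidual (R := R) y : FractionalIdeal R⁰ K) ↔
      ∃ N ∈ maximalTIdealProducts R K, spanSingleton R⁰ x * N ≤ spanSingleton R⁰ y := by
  obtain ⟨r, rfl⟩ := (mem_one_iff R⁰).1 hx
  exact algebraMap_mem_coeIdeal

theorem exists_mul_le_of_fg_le_productResidual {J : FractionalIdeal R⁰ K} {x : K}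
    (hJ : (J : Submodule R K).FG) (hJx : J ≤ (productResidual (R := R) x : FractionalIdeal R⁰ K)) :
    ∃ N ∈ maximalTIdealProducts R K, N * J ≤ spanSingleton R⁰ x := by
  classical
  obtain ⟨s, hs⟩ := hJ
  have key : ∀ t : Finset K,
      (∀ y ∈ t, y ∈ (productResidual (R := R) x : FractionalIdeal R⁰ K)) →
      ∃ N ∈ maximalTIdealProducts R K, ∀ y ∈ t, spanSingleton R⁰ y * N ≤ spanSingleton R⁰ x := by
    intro t
    induction t using Finset.induction_on with
    | empty => exact fun _ => ⟨1, one_mem _, by simp⟩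
    | insert a t _ ih =>
      intro ht
      obtain ⟨A, hA, h1⟩ := ih fun y hy => ht y (Finset.mem_insert_of_mem hy)
      have ha := ht a (Finset.mem_insert_self a t)
      obtain ⟨B, hB, h2⟩ := (mem_productResidual (coeIdeal_le_one ha)).1 ha
      have hAB1 : A * B ≤ A :=
        (mul_le_mul' le_rfl (le_one_of_mem_maximalTIdealProducts hB)).trans_eq (mul_one A)
      have hAB2 : A * B ≤ B :=
        (mul_le_mul' (le_one_of_mem_maximalTIdealProducts hA) le_rfl).trans_eq (one_mul B)
      refine ⟨A * B, mul_mem hA hB, fun y hy => ?_⟩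
      rcases Finset.mem_insert.1 hy with rfl | hy
      · exact (mul_le_mul' le_rfl hAB2).trans h2
      · exact (mul_le_mul' le_rfl hAB1).trans (h1 y hy)
  obtain ⟨N, hN, h⟩ := key s fun y hy => hJx (by
    change y ∈ (J : Submodule R K)
    rw [← hs]
    exact Submodule.subset_span hy)
  refine ⟨N, hN, ?_⟩
  rw [← FractionalIdeal.coe_le_coe, coe_mul, ← hs, Submodule.mul_le]
  intro n hn m hm
  induction hm using Submodule.span_induction with
  | mem y hy =>
    rw [mul_comm]
    exact spanSingleton_mul_le_iff.1 (h y hy) n hn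
  | zero =>
    rw [mul_zero]
    exact Submodule.zero_mem _
  | add a b _ _ ha hb =>
    rw [mul_add]
    exact Submodule.add_mem _ ha hb
  | smul c a _ ha =>
    rw [mul_smul_comm]
    exact Submodule.smul_mem _ c ha

/-- If y ∈ (R:M)^n and xy ∈ R is outside M, then xy·M^n ⊆ xR. So the product residual of x lies in
no maximal `t`-ideal and has `t`-closure R; a finitely generated J inside it with 1 ∈ J_v yields one
product N ⊆ (NJ)_v ⊆ xR. -/
theorem finite_setOf_isMaximalTIdeal_mem
    (ha : ∀ M : FractionalIdeal R⁰ K, IsMaximalTIdeal M → IsArchimedean M) {x : K}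
    (hx : x ∈ (1 : FractionalIdeal R⁰ K)) (hx0 : x ≠ 0) :
    {M : FractionalIdeal R⁰ K | IsMaximalTIdeal M ∧ x ∈ M}.Finite := by
  have hxI : x ∈ (productResidual (R := R) x : FractionalIdeal R⁰ K) :=
    (mem_productResidual hx).2 ⟨1, one_mem _, by rw [mul_one]⟩
  have ht : tClosure (productResidual (R := R) x : FractionalIdeal R⁰ K) = 1 := by
    by_contra hc
    obtain ⟨M, hM, hIM⟩ := exists_le_isMaximalTIdeal (ne_zero_of_mem hxI hx0) coeIdeal_le_one hc
    obtain ⟨n, hn, y, hy, hyM⟩ := ha M hM x hx hx0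
    have hMp : M ∈ maximalTIdealProducts R K := Submonoid.subset_closure hM
    refine hyM (hIM ((mem_productResidual (spanSingleton_mul_le_iff.1 hn y hy)).2
      ⟨M ^ n, pow_mem hMp n, ?_⟩))
    have h1 : (1 / M) ^ n * M ^ n ≤ 1 := by
      rw [← mul_pow, mul_comm]
      exact pow_le_one' (mul_one_div_le M) n
    rw [← spanSingleton_mul_spanSingleton, mul_assoc]
    exact (mul_le_mul' le_rfl ((mul_le_mul' (spanSingleton_le_iff_mem.2 hy) le_rfl).trans
      h1)).trans_eq (mul_one _)
  have h1 := FractionalIdeal.one_mem_one (P := K) R⁰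
  rw [← ht] at h1
  obtain ⟨J, hJ, hJI, h1J⟩ := h1
  obtain ⟨N, hN, hNJ⟩ := exists_mul_le_of_fg_le_productResidual hJ hJI
  have hNx : N ≤ spanSingleton R⁰ x :=
    calc N = N * 1 := (mul_one N).symm
      _ ≤ N * vClosure J := mul_le_mul' le_rfl (FractionalIdeal.one_le.2 h1J)
      _ ≤ vClosure (N * J) := mul_vClosure_le N J
      _ ≤ vClosure (spanSingleton R⁰ x) := vClosure_mono hNJ
      _ = spanSingleton R⁰ x := vClosure_spanSingleton x
  refine (finite_setOf_le_of_mem_maximalTIdealProducts hN).subset ?_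
  rintro M ⟨hM, hxM⟩
  exact ⟨hM, hNx.trans (spanSingleton_le_iff_mem.2 hxM)⟩

theorem isKrullDomain_of_isArchimedean
    (ha : ∀ M : FractionalIdeal R⁰ K, IsMaximalTIdeal M → IsArchimedean M)
    (hs : ∀ M : FractionalIdeal R⁰ K, IsMaximalTIdeal M → ¬ IsStrong M) :
    IsKrullDomain R K := by
  refine ⟨{V | ∃ M : FractionalIdeal R⁰ K, IsMaximalTIdeal M ∧ IsLocalRingAt M V}, ?_, ?_, ?_⟩
  · rintro V ⟨M, hM, hV⟩
    exact (ha M hM).isDiscreteValuationRing hM (hs M hM) hV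
  · intro x
    rw [RingHom.mem_range, ← mem_one_iff R⁰]
    constructor
    · rintro hx V ⟨M, hM, hV⟩
      exact (hV x).2 ⟨1, FractionalIdeal.one_mem_one R⁰, hM.one_notMem, by rwa [one_mul]⟩
    · refine fun h => mem_one_of_forall_isMaximalTIdeal fun M hM => ?_
      obtain ⟨V, hV⟩ := (ha M hM).exists_isLocalRingAt hM (hs M hM)
      exact (hV x).1 (h V ⟨M, hM, hV⟩)
  · intro x hx
    obtain ⟨a, b, hb, rfl⟩ := IsFractionRing.div_surjective (A := R) x
    obtain ⟨ha0, hb0⟩ := div_ne_zero_iff.1 hx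
    have hfin := (finite_setOf_isMaximalTIdeal_mem ha (coe_mem_one R⁰ a) ha0).union
      (finite_setOf_isMaximalTIdeal_mem ha (coe_mem_one R⁰ b) hb0)
    refine (hfin.biUnion (t := fun M => {V | IsLocalRingAt M V}) fun M _ => ?_).subset ?_
    · refine Set.Subsingleton.finite fun V hV W hW => ?_
      ext x
      exact (hV x).trans (hW x).symm
    · rintro V ⟨⟨M, hM, hV⟩, hxV⟩
      refine Set.mem_biUnion (x := M) ?_ hV
      by_contra hc
      simp only [Set.mem_union, Set.mem_ofPred_eq, hM, true_and, not_or] at hc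
      refine hxV ⟨(hV _).2 ⟨_, coe_mem_one R⁰ b, hc.2, ?_⟩,
        (hV _).2 ⟨_, coe_mem_one R⁰ a, hc.1, ?_⟩⟩
      · rw [mul_div_cancel₀ _ hb0]
        exact coe_mem_one R⁰ a
      · rw [inv_div, mul_div_cancel₀ _ ha0]
        exact coe_mem_one R⁰ b

/-! ### Consequences of the Krull property. -/

theorem _root_.ValuationSubring.mem_of_forall_mul_pow_mem {V : ValuationSubring K}
    [IsDiscreteValuationRing V] {x d : K} (hd : d ≠ 0) (h : ∀ n : ℕ, d * x ^ n ∈ V) : x ∈ V := by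
  by_contra hx
  have hy : x⁻¹ ∈ V := (V.mem_or_inv_mem x).resolve_left hx
  have hx0 : x ≠ 0 := fun h0 => hx (h0 ▸ V.zero_mem)
  have hdV : d ∈ V := by simpa using h 0
  have hu : ¬ IsUnit (⟨x⁻¹, hy⟩ : V) := by
    intro hu
    obtain ⟨⟨z, hz⟩, hz1⟩ := hu.exists_right_inv
    have hz2 : x⁻¹ * z = 1 := congrArg Subtype.val hz1
    rw [inv_mul_eq_one₀ hx0] at hz2
    exact hx (hz2 ▸ hz)
  -- The nonunit x⁻¹ divides d only finitely often, yet d = x^(-(n+1))·(d·x^(n+1)) for every n.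
  obtain ⟨n, hn⟩ := FiniteMultiplicity.of_not_isUnit (b := (⟨d, hdV⟩ : V)) hu
    fun h0 => hd (congrArg Subtype.val h0)
  refine hn ⟨⟨d * x ^ (n + 1), h (n + 1)⟩, Subtype.ext ?_⟩
  change d = x⁻¹ ^ (n + 1) * (d * x ^ (n + 1))
  rw [inv_pow, mul_comm, mul_assoc, mul_inv_cancel₀ (pow_ne_zero _ hx0), mul_one]

theorem IsKrullDomain.isCompletelyIntegrallyClosed (h : IsKrullDomain R K) :
    IsCompletelyIntegrallyClosed R K := by
  obtain ⟨S, hS, hR, -⟩ := h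
  refine le_bot_iff.1 fun x hx => ?_
  obtain ⟨d, hd, hdx⟩ := hx
  rw [Algebra.mem_bot]
  refine (hR x).2 fun V hV => ?_
  have := hS V hV
  refine ValuationSubring.mem_of_forall_mul_pow_mem (d := algebraMap R K d) ?_ fun n => ?_
  · simpa using nonZeroDivisors.ne_zero hd
  · rw [← Algebra.smul_def]
    exact (hR _).1 (hdx n) V hV

theorem exists_mem_forall_div_mem {V : ValuationSubring K} [IsDiscreteValuationRing V]
    {A : FractionalIdeal R⁰ K} (hA : A ≠ 0) (hAV : ∀ x ∈ A, x ∈ V) :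
    ∃ b ∈ A, b ≠ 0 ∧ ∀ x ∈ A, x / b ∈ V := by
  obtain ⟨a, ha, ha0⟩ := exists_mem_ne_zero hA
  obtain ⟨b, ⟨hbA, hb0⟩, hb⟩ := (InvImage.wf (IsDiscreteValuationRing.addVal V)
    wellFounded_lt).has_min {v : V | (v : K) ∈ A ∧ (v : K) ≠ 0} ⟨⟨a, hAV a ha⟩, ha, ha0⟩
  refine ⟨b, hbA, hb0, fun x hx => ?_⟩
  by_cases hx0 : x = 0
  · rw [hx0, zero_div]
    exact V.zero_mem
  obtain ⟨c, hc⟩ := IsDiscreteValuationRing.addVal_le_iff_dvd.1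
    (not_lt.1 (hb ⟨x, hAV x hx⟩ ⟨hx, hx0⟩))
  have hc' : x = b * c := congrArg Subtype.val hc
  rw [hc', mul_div_cancel_left₀ _ hb0]
  exact c.2

theorem IsKrullDomain.exists_fg_one_div_eq (h : IsKrullDomain R K) {A : FractionalIdeal R⁰ K}
    (hA : A ≠ 0) (hA1 : A ≤ 1) :
    ∃ J : FractionalIdeal R⁰ K, (J : Submodule R K).FG ∧ J ≤ A ∧ 1 / J = 1 / A := by
  obtain ⟨S, hS, hR, hfin⟩ := h
  simp only [RingHom.mem_range, ← mem_one_iff R⁰] at hR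
  obtain ⟨a, haA, ha0⟩ := exists_mem_ne_zero hA
  have hmin : ∀ V : ValuationSubring K, ∃ b ∈ A, V ∈ S → b ≠ 0 ∧ ∀ x ∈ A, x / b ∈ V := by
    intro V
    by_cases hV : V ∈ S
    · have := hS V hV
      obtain ⟨b, hb, h⟩ := exists_mem_forall_div_mem hA fun x hx => (hR x).1 (hA1 hx) V hV
      exact ⟨b, hb, fun _ => h⟩
    · exact ⟨a, haA, fun h => absurd h hV⟩
  choose b hbA hb using hmin
  -- The element a has minimal value wherever it is a unit; at the finitely many other V, b V does.
  -- So T attains the minimal value of A at every V in S.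
  let T : Set K := insert a (b '' {V ∈ S | ¬ (a ∈ V ∧ a⁻¹ ∈ V)})
  have hT : T.Finite := ((hfin a ha0).image b).insert a
  have hTA : Submodule.span R T ≤ (A : Submodule R K) := by
    refine Submodule.span_le.2 ?_
    rintro x (rfl | ⟨V, -, rfl⟩)
    exacts [haA, hbA V]
  let J : FractionalIdeal R⁰ K := ⟨Submodule.span R T, isFractional_of_le hTA⟩
  have hTJ : ∀ x ∈ T, x ∈ J := fun x hx => Submodule.subset_span hx
  have hJ0 : J ≠ 0 := ne_zero_of_mem (hTJ a (Set.mem_insert a _)) ha0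
  refine ⟨J, Submodule.fg_span hT, hTA, le_antisymm (fun x hx => ?_) (one_div_antitone hJ0 hTA)⟩
  have hx' := (mem_one_div hJ0 x).1 hx
  refine (mem_one_div hA x).2 fun y hy => (hR _).2 fun V hV => ?_
  by_cases hV' : a ∈ V ∧ a⁻¹ ∈ V
  · have h1 := (hR _).1 (hx' a (hTJ a (Set.mem_insert a _))) V hV
    have h2 := V.mul_mem _ _ h1 (V.mul_mem _ _ hV'.2 ((hR y).1 (hA1 hy) V hV))
    convert h2 using 1
    field_simp
  · have h1 := (hR _).1 (hx' (b V) (hTJ _ (Set.mem_insert_of_mem a ⟨V, ⟨hV, hV'⟩, rfl⟩))) V hV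
    have h2 := V.mul_mem _ _ h1 ((hb V hV).2 y hy)
    have hb0 := (hb V hV).1
    convert h2 using 1
    field_simp

theorem IsKrullDomain.isTInvertible (h : IsKrullDomain R K) {I : FractionalIdeal R⁰ K}
    (hI : I ≠ 0) : IsTInvertible I := by
  have hI' := one_div_ne_zero' hI
  have hA : I * (1 / I) ≠ 0 := mul_ne_zero_of_ne_zero hI hI'
  obtain ⟨J, hJ, hJA, hJ1⟩ := h.exists_fg_one_div_eq hA (mul_one_div_le I)
  have hle : 1 / (I * (1 / I)) ≤ 1 := by
    -- Anything carrying I(R:I) into R carries (R:I) into itself.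
    refine le_trans (fun x hx => ?_) (h.isCompletelyIntegrallyClosed.div_self_le hI')
    have hx' := (mem_one_div hA x).1 hx
    refine (mem_colon hI' _ x).2 fun y hy => (mem_one_div hI _).2 fun z hz => ?_
    have := hx' _ (FractionalIdeal.mul_mem_mul hz hy)
    convert this using 1
    ring
  refine ⟨hI, eq_one_of_one_mem (tClosure_le_one (mul_one_div_le I)) ⟨J, hJ, hJA, ?_⟩⟩
  rw [vClosure, hJ1, mem_one_div (one_div_ne_zero' hA)]
  intro y hy
  rw [one_mul]
  exact hle hy

end Krull

end StarIdeal

theorem mainTheorem6 (R : Type*) [CommRing R] [IsDomain R]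
    (K : Type*) [Field K] [Algebra R K] [IsFractionRing R K] :
    List.TFAE [
      ¬ ∃ I : FractionalIdeal R⁰ K,
        StarIdeal.IsProper I ∧ StarIdeal.IsStrong I ∧ StarIdeal.IsTIdeal I,
      ¬ ∃ P : FractionalIdeal R⁰ K,
        StarIdeal.IsPrimeIdeal P ∧ StarIdeal.IsStrong P ∧ StarIdeal.IsTIdeal P,
      (¬ ∃ P : FractionalIdeal R⁰ K,
        StarIdeal.IsPrimeIdeal P ∧ StarIdeal.IsStronglyDivisorial P) ∧
        ∀ M : FractionalIdeal R⁰ K, StarIdeal.IsMaximalTIdeal M → StarIdeal.IsTInvertible M,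
      (¬ ∃ P : FractionalIdeal R⁰ K,
        StarIdeal.IsPrimeIdeal P ∧ StarIdeal.IsStronglyDivisorial P) ∧
        ∀ M : FractionalIdeal R⁰ K, StarIdeal.IsMaximalTIdeal M → StarIdeal.IsDivisorial M,
      StarIdeal.IsCompletelyIntegrallyClosed R K ∧
        ∀ M : FractionalIdeal R⁰ K, StarIdeal.IsMaximalTIdeal M → StarIdeal.IsDivisorial M,
      StarIdeal.IsKrullDomain R K,
      ∀ I : FractionalIdeal R⁰ K, StarIdeal.IsTIdeal I → StarIdeal.IsTInvertible I] := by
  tfae_have 1 → 2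
  | h, ⟨P, hP, hPs⟩ => h ⟨P, hP.isProper, hPs⟩
  tfae_have 2 → 3
  | h => ⟨fun ⟨P, hP, hPs⟩ => h ⟨P, hP, hPs.1, hPs.2.isTIdeal⟩,
      fun M hM => hM.isTInvertible fun hs => h ⟨M, hM.isPrimeIdeal, hs, hM.1.1⟩⟩
  tfae_have 3 → 4
  | h => ⟨h.1, fun M hM => (h.2 M hM).isDivisorial hM.1.1⟩
  tfae_have 4 → 6
  | h => StarIdeal.isKrullDomain_of_isArchimedean
      (fun M hM => StarIdeal.isArchimedean_of_no_stronglyDivisorial_prime h.1 hM (h.2 M hM))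
      -- A strong M would itself be a forbidden strongly divisorial prime.
      fun M hM hs => h.1 ⟨M, hM.isPrimeIdeal, hs, h.2 M hM⟩
  tfae_have 6 → 7
  | h, I, hI => h.isTInvertible hI.1
  tfae_have 7 → 1
  | h, ⟨I, hI, hs, ht⟩ => (h I ht).not_isStrong ht hI hs
  tfae_have 6 → 5
  | h => ⟨h.isCompletelyIntegrallyClosed, fun M hM =>
      (h.isTInvertible hM.ne_zero).isDivisorial hM.1.1⟩
  tfae_have 5 → 4
  | h => ⟨fun ⟨P, hP, hPs⟩ => h.1.not_isStronglyDivisorial hP.isProper hPs, h.2⟩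
  tfae_finish
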